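/- Fix a countably infinite set of propositional variables. Formulas of $\mathcal{L}_{\bot,\supset}$ are built from the variables and $\bot$ with the binary connectives $\land,\lor,\to,\supset$. A formula is disjunction-free (i.e. in $\mathcal{L}^-_{\bot,\supset}$) if $\lor$ does not occur in it. An $\mathbf{S}^-_\bot$-model is a triple $\langle W,\le,V\rangle$ where $\le$ is a reflexive and transitive relation on the set $W$ and $V:W\times\mathsf{Prop}\to\{0,1\}$ is such that $V(w,p)=1$ and $w\le w'$ imply $V(w',p)=1$. Truth at a state is given by $I(w,p)=V(w,p)$; $I(w,\bot)=0$; $I(w,A\land B)=1$ iff $I(w,A)=1$ and $I(w,B)=1$; $I(w,A\lor B)=1$ iff $I(w,A)=1$ or $I(w,B)=1$; $I(w,A\to B)=1$ iff for all $x\ge w$, $I(x,A)=1$ implies $I(x,B)=1$; $I(w,A\supset B)=1$ iff $I(x,A)\ne 1$ for some $x\in W$ or $I(w,B)=1$. An $\mathbf{S}_\bot$-model is an $\mathbf{S}^-_\bot$-model with a base state, i.e. a state $g$ with $g\le w$ for all $w\in W$. Write $\models_\supset A$ (respectively $\models_\bot A$) if $I(w,A)=1$ for all states $w$ of all $\mathbf{S}^-_\bot$-models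 (respectively of all $\mathbf{S}_\bot$-models). For distinct variables $p,q,r$, the system $\mathbf{S}^-_\bot2$ has the axioms $$\bot\to p,\quad p\to(q\to p),\quad (p\to(q\to r))\to((p\to q)\to(p\to r)),$$ $$(p\land q)\to p,\quad (p\land q)\to q,\quad (r\to p)\to((r\to q)\to(r\to(p\land q))),$$ $$p\to(p\lor q),\quad q\to(p\lor q),\quad (p\to r)\to((q\to r)\to((p\lor q)\to r)),$$ $$(p\to q)\supset(p\supset q),\quad (p\supset(q\supset r))\to((p\supset q)\supset(p\supset r)),$$ $$(p\supset(q\to r))\to(q\to(p\supset r)),\quad (p\to(q\supset r))\to(q\supset(p\to r)),$$ $$((p\supset q)\supset r)\to((p\supset r)\to r),$$ and the rules: from $A$ and $A\supset B$ infer $B$; from $A$ infer $A[s/B]$ (the result of replacing every occurrence of the variable $s$ in $A$ by the formula $B$). The system $\mathbf{S}_\bot2$ has in addition the axiom $(p\supset r)\to((q\supset r)\to((p\lor q)\supset r))$. Let $A$ be a disjunction-free formula. Then: 1. if $\models_\bot A$, then $\models_\supset A$; 2. if $\mathbf{S}_\bot2\vdash A$, then $\mathbf{S}^-_\bot2\vdash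 A$. -/

import Mathlib

universe u

namespace SLogic

/-- Formulas of the language with absurdity, conjunction, disjunction, the intuitionistic
conditional (`imp`) and the classical conditional (`sup`), over the countably infinite set
of propositional variables indexed by the natural numbers. -/
inductive Form : Type
  | var : ℕ → Form
  | bot : Form
  | and : Form → Form → Form
  | or : Form → Form → Form
  | imp : Form → Form → Form
  | sup : Form → Form → Form

local infixr:60 " ⟶ " => Form.imp
local infixr:60 " ⊐ " => Form.sup
local infixl:70 " ⋏ " => Form.and
local infixl:65 " ⋎ " => Form.or

/-- The formulas of the disjunction-free sublanguage. -/
def Form.DisjFree : Form → Prop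
  | .var _ => True
  | .bot => True
  | .and A B => A.DisjFree ∧ B.DisjFree
  | .or _ _ => False
  | .imp A B => A.DisjFree ∧ B.DisjFree
  | .sup A B => A.DisjFree ∧ B.DisjFree

/-- `A.subst p B` is `A[p/B]`: every occurrence of the variable `p` in `A` is replaced by `B`. -/
def Form.subst (A : Form) (p : ℕ) (B : Form) : Form :=
  match A with
  | .var q => if q = p then B else .var q
  | .bot => .bot
  | .and C D => .and (C.subst p B) (D.subst p B)
  | .or C D => .or (C.subst p B) (D.subst p B)
  | .imp C D => .imp (C.subst p B) (D.subst p B)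
  | .sup C D => .sup (C.subst p B) (D.subst p B)

/-! ### Models -/

/-- A model (without a base state): a preordered set of states with a persistent valuation. -/
structure Model : Type (u + 1) where
  W : Type u
  le : W → W → Prop
  le_refl : ∀ w, le w w
  le_trans : ∀ u v w, le u v → le v w → le u w
  V : W → ℕ → Prop
  persistent : ∀ u v p, le u v → V u p → V v p

/-- Truth of a formula at a state of a model. The classical conditional `A ⊐ B` holds at `w`
iff `A` fails at some state of the model or `B` holds at `w`. -/
def Model.Holds (M : Model.{u}) : M.W → Form → Prop
  | w, .var p => M.V w p
  | _, .bot => False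
  | w, .and A B => M.Holds w A ∧ M.Holds w B
  | w, .or A B => M.Holds w A ∨ M.Holds w B
  | w, .imp A B => ∀ x, M.le w x → M.Holds x A → M.Holds x B
  | w, .sup A B => (∃ x, ¬ M.Holds x A) ∨ M.Holds w B

/-- The model has a base state, that is, a least state. -/
def Model.HasBase (M : Model.{u}) : Prop := ∃ g, ∀ w, M.le g w

/-- Validity over all models, with or without a base state. -/
def ValidSMinusBot (A : Form) : Prop := ∀ (M : Model.{u}) (w : M.W), M.Holds w A

/-- Validity over the models with a base state. -/
def ValidSBot (A : Form) : Prop := ∀ M : Model.{u}, M.HasBase → ∀ w : M.W, M.Holds w A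

/-! ### Axiomatic systems with single axioms and a rule of substitution -/

/-- The first of the three (distinct) propositional variables used in the axioms. -/
abbrev vp : Form := .var 0
/-- The second propositional variable used in the axioms. -/
abbrev vq : Form := .var 1
/-- The third propositional variable used in the axioms. -/
abbrev vr : Form := .var 2

/-- The axioms of the system without the disjunction axiom for the classical conditional. -/
inductive AxSMinusBot2 : Form → Prop
  | ax0 : AxSMinusBot2 (.bot ⟶ vp)
  | ax1 : AxSMinusBot2 (vp ⟶ (vq ⟶ vp))
  | ax2 : AxSMinusBot2 ((vp ⟶ (vq ⟶ vr)) ⟶ ((vp ⟶ vq) ⟶ (vp ⟶ vr)))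
  | ax3 : AxSMinusBot2 ((vp ⋏ vq) ⟶ vp)
  | ax4 : AxSMinusBot2 ((vp ⋏ vq) ⟶ vq)
  | ax5 : AxSMinusBot2 ((vr ⟶ vp) ⟶ ((vr ⟶ vq) ⟶ (vr ⟶ (vp ⋏ vq))))
  | ax6 : AxSMinusBot2 (vp ⟶ (vp ⋎ vq))
  | ax7 : AxSMinusBot2 (vq ⟶ (vp ⋎ vq))
  | ax8 : AxSMinusBot2 ((vp ⟶ vr) ⟶ ((vq ⟶ vr) ⟶ ((vp ⋎ vq) ⟶ vr)))
  | axM1 : AxSMinusBot2 ((vp ⟶ vq) ⊐ (vp ⊐ vq))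
  | axM2 : AxSMinusBot2 ((vp ⊐ (vq ⊐ vr)) ⟶ ((vp ⊐ vq) ⊐ (vp ⊐ vr)))
  | axM3 : AxSMinusBot2 ((vp ⊐ (vq ⟶ vr)) ⟶ (vq ⟶ (vp ⊐ vr)))
  | axM4 : AxSMinusBot2 ((vp ⟶ (vq ⊐ vr)) ⟶ (vq ⊐ (vp ⟶ vr)))
  | axM5 : AxSMinusBot2 (((vp ⊐ vq) ⊐ vr) ⟶ ((vp ⊐ vr) ⟶ vr))

/-- The axioms of the full system: those above and the disjunction axiom for the classical
conditional. -/
inductive AxSBot2 : Form → Prop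
  | base {A : Form} : AxSMinusBot2 A → AxSBot2 A
  | axM6 : AxSBot2 ((vp ⊐ vr) ⟶ ((vq ⊐ vr) ⟶ ((vp ⋎ vq) ⊐ vr)))

/-- Theorems of the system with axioms `Ax`, modus ponens for the classical conditional, and
substitution of a formula for a propositional variable. -/
inductive Provable (Ax : Form → Prop) : Form → Prop
  | ax {A : Form} : Ax A → Provable Ax A
  | mp {A B : Form} : Provable Ax A → Provable Ax (A ⊐ B) → Provable Ax B
  | sub {A : Form} (p : ℕ) (B : Form) : Provable Ax A → Provable Ax (A.subst p B)

end SLogic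

/-!
The semantic half rests on adding a base state `g` to a model, where `g` verifies exactly the
variables true at every old state. For a disjunction-free formula, truth at the old states is
unchanged and truth at `g` amounts to truth at all old states (`Model.holds_addBase`); in
particular the same disjunction-free formulas are globally true, so the classical conditional is
not disturbed. Disjunction is excluded because `A ⋎ B` may hold everywhere while neither `A` nor
`B` does.

The syntactic half follows from the semantic half, the soundness of the full system for models
with a base state (`Provable.validSBot`), and the completeness of the smaller system for all
models (`provable_of_validSMinusBot`). For completeness, let `A` be unprovable, and let `Γ` be a
maximal set of formulas that contains the theorems, is closed under modus ponens for `⊐`, and omits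
`A`. The set `Γ` plays the role of the formulas true at every state: the states are the consistent
prime theories (for `⟶`) that include `Γ`, ordered by inclusion, and the formulas that belong to
all of them are those of `Γ`. The formula `B ⊐ C` belongs to a state `Δ` iff `B ∉ Γ` or `C ∈ Δ`:
if `B ∈ Γ`, then `(B ⊐ C) ⟶ C` is in `Γ` by the fourth mixed axiom, whereas if `B ∉ Γ`, then
`B ⊐ A` is in `Γ` by maximality, and the Peirce-like fifth mixed axiom puts `B ⊐ C` into `Γ`.
-/

namespace SLogic

local infixr:60 " ⟶ " => Form.imp
local infixr:60 " ⊐ " => Form.sup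
local infixl:70 " ⋏ " => Form.and
local infixl:65 " ⋎ " => Form.or

/-! ### Adding a base state -/

/-- The model `M` with a new least state `none`, at which a variable is true iff it is true at
every state of `M`. -/
def Model.addBase (M : Model.{u}) : Model.{u} where
  W := Option M.W
  le
    | none, _ => True
    | some _, none => False
    | some u, some v => M.le u v
  le_refl
    | none => trivial
    | some w => M.le_refl w
  le_trans
    | none, _, _, _, _ => trivial
    | some _, none, _, h, _ => h.elim
    | some _, some _, none, _, h => h.elim
    | some u, some v, some w, h, h' => M.le_trans u v w h h'
  V
    | none, p => ∀ w, M.V w p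
    | some w, p => M.V w p
  persistent
    | none, none, _, _, h => h
    | none, some v, _, _, h => h v
    | some _, none, _, h, _ => h.elim
    | some u, some v, p, h, h' => M.persistent u v p h h'

theorem Model.hasBase_addBase (M : Model.{u}) : M.addBase.HasBase :=
  ⟨none, fun _ => trivial⟩

theorem Model.holds_addBase (M : Model.{u}) (hM : Nonempty M.W) {A : Form} (hA : A.DisjFree) :
    (∀ w : M.W, M.addBase.Holds (some w) A ↔ M.Holds w A) ∧
      (M.addBase.Holds none A ↔ ∀ w : M.W, M.Holds w A) := by
  induction A with
  | var p => exact ⟨fun _ => Iff.rfl, Iff.rfl⟩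
  | bot => exact ⟨fun _ => Iff.rfl, fun h => h.elim, fun h => h hM.some⟩
  | and A B ihA ihB =>
    obtain ⟨a, a'⟩ := ihA hA.1
    obtain ⟨b, b'⟩ := ihB hA.2
    exact ⟨fun w => and_congr (a w) (b w), (and_congr a' b').trans forall_and.symm⟩
  | or A B => exact hA.elim
  | imp A B ihA ihB =>
    obtain ⟨a, a'⟩ := ihA hA.1
    obtain ⟨b, b'⟩ := ihB hA.2
    have key : ∀ w : M.W, M.addBase.Holds (some w) (A ⟶ B) ↔ M.Holds w (A ⟶ B) := by
      refine fun w => ⟨fun h x hx hxA => (b x).1 (h (some x) hx ((a x).2 hxA)), ?_⟩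
      rintro h (_ | x) hx hxA
      · exact hx.elim
      · exact (b x).2 (h x hx ((a x).1 hxA))
    refine ⟨key, fun h w => (key w).1 fun x _ => h x trivial, ?_⟩
    rintro h (_ | x) - hxA
    · exact b'.2 fun w => h w w (M.le_refl w) (a'.1 hxA w)
    · exact (b x).2 (h x x (M.le_refl x) ((a x).1 hxA))
  | sup A B ihA ihB =>
    obtain ⟨a, a'⟩ := ihA hA.1
    obtain ⟨b, b'⟩ := ihB hA.2
    have key : (∃ x, ¬ M.addBase.Holds x A) ↔ ∃ x, ¬ M.Holds x A := by
      constructor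
      · rintro ⟨_ | x, hx⟩
        · exact not_forall.1 fun h => hx (a'.2 h)
        · exact ⟨x, fun h => hx ((a x).2 h)⟩
      · rintro ⟨x, hx⟩
        exact ⟨some x, fun h => hx ((a x).1 h)⟩
    exact ⟨fun w => or_congr key (b w), (or_congr key b').trans forall_or_left.symm⟩

theorem ValidSBot.validSMinusBot {A : Form} (hA : A.DisjFree) (h : ValidSBot.{u} A) :
    ValidSMinusBot.{u} A := fun M w =>
  ((M.holds_addBase ⟨w⟩ hA).1 w).1 (h M.addBase M.hasBase_addBase (some w))

/-! ### Soundness for models with a base state -/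

theorem Model.Holds.mono {M : Model.{u}} {A : Form} :
    ∀ {w x : M.W}, M.le w x → M.Holds w A → M.Holds x A := by
  induction A with
  | var p => exact fun h => M.persistent _ _ p h
  | bot => exact fun _ h => h
  | and A B ihA ihB => exact fun h => And.imp (ihA h) (ihB h)
  | or A B ihA ihB => exact fun h => Or.imp (ihA h) (ihB h)
  | imp A B => exact fun h hw y hy => hw y (M.le_trans _ _ _ h hy)
  | sup A B _ ihB => exact fun h => Or.imp id (ihB h)

/-- The model `M` with the valuation of the variable `p` changed to the truth of the formula
`B`. -/
def Model.update (M : Model.{u}) (p : ℕ) (B : Form) : Model.{u} where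
  W := M.W
  le := M.le
  le_refl := M.le_refl
  le_trans := M.le_trans
  V w q := if q = p then M.Holds w B else M.V w q
  persistent u v q h := by
    split
    · exact Model.Holds.mono h
    · exact M.persistent u v q h

theorem Model.holds_subst (M : Model.{u}) (p : ℕ) (A B : Form) :
    ∀ w : M.W, M.Holds w (A.subst p B) ↔ (M.update p B).Holds w A := by
  induction A with
  | var q =>
    intro w
    by_cases h : q = p <;> simp [Form.subst, Model.Holds, Model.update, h]
  | bot => exact fun _ => Iff.rfl
  | and C D ihC ihD => exact fun w => and_congr (ihC w) (ihD w)
  | or C D ihC ihD => exact fun w => or_congr (ihC w) (ihD w)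
  | imp C D ihC ihD =>
    exact fun w => forall_congr' fun x => imp_congr Iff.rfl (imp_congr (ihC x) (ihD x))
  | sup C D ihC ihD =>
    exact fun w => or_congr (exists_congr fun x => not_congr (ihC x)) (ihD w)

theorem Model.holds_sup_iff {M : Model.{u}} {w : M.W} {A B : Form} :
    M.Holds w (A ⊐ B) ↔ ((∀ x, M.Holds x A) → M.Holds w B) := by
  change (∃ x, ¬ M.Holds x A) ∨ M.Holds w B ↔ _
  rw [← not_forall, ← imp_iff_not_or]

theorem AxSMinusBot2.validSMinusBot {A : Form} (h : AxSMinusBot2 A) : ValidSMinusBot.{u} A := by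
  intro M w
  cases h with
  | ax0 => exact fun x _ h => h.elim
  | ax1 => exact fun x _ h y hy _ => h.mono hy
  | ax2 =>
    exact fun x _ h y hy h' z hz hp =>
      h z (M.le_trans _ _ _ hy hz) hp z (M.le_refl z) (h' z hz hp)
  | ax3 => exact fun x _ h => h.1
  | ax4 => exact fun x _ h => h.2
  | ax5 =>
    exact fun x _ h y hy h' z hz hr => ⟨h z (M.le_trans _ _ _ hy hz) hr, h' z hz hr⟩
  | ax6 => exact fun x _ h => Or.inl h
  | ax7 => exact fun x _ h => Or.inr h
  | ax8 =>
    exact fun x _ h y hy h' z hz hpq =>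
      hpq.elim (h z (M.le_trans _ _ _ hy hz)) (h' z hz)
  | axM1 =>
    simp only [Model.holds_sup_iff]
    exact fun h hp => h w w (M.le_refl w) (hp w)
  | axM2 =>
    intro x _
    simp only [Model.holds_sup_iff]
    exact fun h h' hp => h hp fun y => h' y hp
  | axM3 =>
    intro x _ h y hy hq
    simp only [Model.holds_sup_iff] at h ⊢
    exact fun hp => h hp y hy hq
  | axM4 =>
    intro x _ h
    rw [Model.holds_sup_iff]
    exact fun hq y hy hp => Model.holds_sup_iff.1 (h y hy hp) hq
  | axM5 =>
    intro x _ h y hy h'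
    simp only [Model.holds_sup_iff] at h h'
    by_cases hp : ∀ z, M.Holds z vp
    · exact h' hp
    · exact Model.Holds.mono hy (h fun z hz => (hp hz).elim)

theorem AxSBot2.validSBot {A : Form} (h : AxSBot2 A) : ValidSBot.{u} A := by
  intro M ⟨g, hg⟩ w
  cases h with
  | base h => exact h.validSMinusBot M w
  | axM6 =>
    intro x _ h y hy h'
    simp only [Model.holds_sup_iff] at h h' ⊢
    intro hpq
    -- A disjunction true at every state has a disjunct true at the base state, hence everywhere.
    rcases hpq g with hp | hq
    · exact Model.Holds.mono hy (h fun z => Model.Holds.mono (hg z) hp)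
    · exact h' fun z => Model.Holds.mono (hg z) hq

theorem Provable.validSBot {A : Form} (h : Provable AxSBot2 A) : ValidSBot.{u} A := by
  induction h with
  | ax h => exact h.validSBot
  | mp _ _ ihA ihAB =>
    exact fun M hM w => Model.holds_sup_iff.1 (ihAB M hM w) (ihA M hM)
  | sub p B _ ih =>
    exact fun M hM w => (M.holds_subst p _ B w).2 (ih (M.update p B) hM w)

/-! ### Axiom schemata from single axioms -/

/-- Simultaneous substitution of `A`, `B`, `C` for the variables `0`, `1`, and all others,
respectively. -/
def Form.inst (D A B C : Form) : Form :=
  match D with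
  | .var 0 => A
  | .var 1 => B
  | .var _ => C
  | .bot => .bot
  | .and D E => .and (D.inst A B C) (E.inst A B C)
  | .or D E => .or (D.inst A B C) (E.inst A B C)
  | .imp D E => .imp (D.inst A B C) (E.inst A B C)
  | .sup D E => .sup (D.inst A B C) (E.inst A B C)

/-- All variables of the formula are less than `n`. -/
def Form.VarsLT (n : ℕ) : Form → Prop
  | .var p => p < n
  | .bot => True
  | .and A B => A.VarsLT n ∧ B.VarsLT n
  | .or A B => A.VarsLT n ∧ B.VarsLT n
  | .imp A B => A.VarsLT n ∧ B.VarsLT n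
  | .sup A B => A.VarsLT n ∧ B.VarsLT n

theorem Form.VarsLT.mono {m n : ℕ} (h : m ≤ n) {A : Form} : A.VarsLT m → A.VarsLT n := by
  induction A with
  | var p => exact fun hp => lt_of_lt_of_le hp h
  | bot => exact id
  | and A B ihA ihB => exact And.imp ihA ihB
  | or A B ihA ihB => exact And.imp ihA ihB
  | imp A B ihA ihB => exact And.imp ihA ihB
  | sup A B ihA ihB => exact And.imp ihA ihB

theorem Form.exists_varsLT (A : Form) : ∃ n, A.VarsLT n := by
  have pair {A B : Form} : (∃ n, A.VarsLT n) → (∃ n, B.VarsLT n) →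
      ∃ n, A.VarsLT n ∧ B.VarsLT n :=
    fun ⟨m, hm⟩ ⟨n, hn⟩ => ⟨max m n, hm.mono (le_max_left m n), hn.mono (le_max_right m n)⟩
  induction A with
  | var p => exact ⟨p + 1, Nat.lt_succ_self p⟩
  | bot => exact ⟨0, trivial⟩
  | and A B ihA ihB => exact pair ihA ihB
  | or A B ihA ihB => exact pair ihA ihB
  | imp A B ihA ihB => exact pair ihA ihB
  | sup A B ihA ihB => exact pair ihA ihB

theorem Form.VarsLT.subst_eq {n p : ℕ} (hp : n ≤ p) (B : Form) {A : Form} (h : A.VarsLT n) :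
    A.subst p B = A := by
  induction A with
  | var q => exact if_neg (ne_of_lt (lt_of_lt_of_le h hp))
  | bot => rfl
  | and A B ihA ihB => exact congrArg₂ Form.and (ihA h.1) (ihB h.2)
  | or A B ihA ihB => exact congrArg₂ Form.or (ihA h.1) (ihB h.2)
  | imp A B ihA ihB => exact congrArg₂ Form.imp (ihA h.1) (ihB h.2)
  | sup A B ihA ihB => exact congrArg₂ Form.sup (ihA h.1) (ihB h.2)

/-- A simultaneous substitution is a composite of single ones: the variables `1` and `2` are
renamed to fresh variables `n` and `n + 1` first. -/
theorem Form.inst_eq_subst {A B C : Form} {n : ℕ} (hn : 3 ≤ n) (hA : A.VarsLT n)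
    (hB : B.VarsLT n) {D : Form} (hD : D.VarsLT 3) :
    ((((D.subst 1 (.var n)).subst 2 (.var (n + 1))).subst 0 A).subst n B).subst (n + 1) C =
      D.inst A B C := by
  induction D with
  | var p =>
    have hp : p < 3 := hD
    have h0 : n ≠ 0 := by omega
    have h2 : n ≠ 2 := by omega
    interval_cases p
    · simp [Form.subst, Form.inst, hA.subst_eq le_rfl, hA.subst_eq n.le_succ]
    · simp [Form.subst, Form.inst, h0, h2, hB.subst_eq n.le_succ]
    · simp [Form.subst, Form.inst]
  | bot => rfl
  | and D E ihD ihE => exact congrArg₂ Form.and (ihD hD.1) (ihE hD.2)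
  | or D E ihD ihE => exact congrArg₂ Form.or (ihD hD.1) (ihE hD.2)
  | imp D E ihD ihE => exact congrArg₂ Form.imp (ihD hD.1) (ihE hD.2)
  | sup D E ihD ihE => exact congrArg₂ Form.sup (ihD hD.1) (ihE hD.2)

theorem AxSMinusBot2.varsLT {A : Form} (h : AxSMinusBot2 A) : A.VarsLT 3 := by
  cases h <;> simp [Form.VarsLT]

theorem AxSMinusBot2.provable_inst {D : Form} (h : AxSMinusBot2 D) (A B C : Form) :
    Provable AxSMinusBot2 (D.inst A B C) := by
  obtain ⟨a, ha⟩ := A.exists_varsLT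
  obtain ⟨b, hb⟩ := B.exists_varsLT
  have hn : 3 ≤ 3 + a + b := by omega
  rw [← Form.inst_eq_subst hn (ha.mono (by omega)) (hb.mono (by omega)) h.varsLT]
  exact .sub _ _ (.sub _ _ (.sub _ _ (.sub _ _ (.sub _ _ (.ax h)))))

/-! ### Theories and maximality -/

/-- A set of formulas that is closed under modus ponens for the connective `c`, which is `⟶` or
`⊐` below, and contains the instances of the schemata needed for the deduction theorem. -/
structure IsTheory (c : Form → Form → Form) (T : Set Form) : Prop where
  refl_mem : ∀ A, c A A ∈ T
  const_mem : ∀ A B, c A (c B A) ∈ T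
  distrib_mem : ∀ A B C, c (c A (c B C)) (c (c A B) (c A C)) ∈ T
  mp : ∀ {A B}, c A B ∈ T → A ∈ T → B ∈ T

namespace IsTheory

variable {c : Form → Form → Form} {T : Set Form} {A : Form}

theorem of_subset {U : Set Form} (h : IsTheory c T) (hTU : T ⊆ U)
    (hU : ∀ {A B}, c A B ∈ U → A ∈ U → B ∈ U) : IsTheory c U where
  refl_mem A := hTU (h.refl_mem A)
  const_mem A B := hTU (h.const_mem A B)
  distrib_mem A B C := hTU (h.distrib_mem A B C)
  mp := hU

theorem weaken (h : IsTheory c T) (B : Form) (hA : A ∈ T) : c B A ∈ T :=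
  h.mp (h.const_mem A B) hA

theorem subset_adjoin (h : IsTheory c T) (B : Form) : T ⊆ {C | c B C ∈ T} :=
  fun _ hC => h.weaken B hC

/-- The deduction theorem: the formulas that `B` implies in `T` form a theory, which is the one
generated by `T` and `B`. -/
theorem adjoin (h : IsTheory c T) (B : Form) : IsTheory c {C | c B C ∈ T} :=
  h.of_subset (h.subset_adjoin B) fun hCD hC => h.mp (h.mp (h.distrib_mem _ _ _) hCD) hC

/-- Lindenbaum's lemma. A theory maximal among those that omit `A` contains `c B A` for every
formula `B` outside it, as otherwise `B` could be adjoined. -/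
theorem exists_maximal (h : IsTheory c T) (hA : A ∉ T) :
    ∃ U, T ⊆ U ∧ IsTheory c U ∧ A ∉ U ∧ ∀ B ∉ U, c B A ∈ U := by
  obtain ⟨U, hTU, hU⟩ := zorn_subset_nonempty {U | IsTheory c U ∧ A ∉ U} (by
    intro S hS hchain hne
    refine ⟨⋃₀ S, ⟨?_, ?_⟩, fun s hs => Set.subset_sUnion_of_mem hs⟩
    · obtain ⟨s, hs⟩ := hne
      refine (hS hs).1.of_subset (Set.subset_sUnion_of_mem hs) ?_
      rintro B C ⟨t, ht, hBC⟩ ⟨u, hu, hB⟩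
      rcases hchain.total ht hu with htu | hut
      · exact ⟨u, hu, (hS hu).1.mp (htu hBC) hB⟩
      · exact ⟨t, ht, (hS ht).1.mp hBC (hut hB)⟩
    · rintro ⟨s, hs, hAs⟩
      exact (hS hs).2 hAs) T ⟨h, hA⟩
  refine ⟨U, hTU, hU.prop.1, hU.prop.2, fun B hB => ?_⟩
  by_contra hBA
  exact hB (hU.le_of_ge (y := {C | c B C ∈ U}) ⟨hU.prop.1.adjoin B, hBA⟩
    (hU.prop.1.subset_adjoin B) (hU.prop.1.refl_mem B))

end IsTheory

/-! ### The canonical model -/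

/-- A set of formulas that contains the theorems of the smaller system and is closed under its
modus ponens. -/
structure IsGlobal (Γ : Set Form) : Prop where
  provable_mem : ∀ {A}, Provable AxSMinusBot2 A → A ∈ Γ
  mp : ∀ {A B}, A ⊐ B ∈ Γ → A ∈ Γ → B ∈ Γ

theorem isGlobal_provable : IsGlobal {A | Provable AxSMinusBot2 A} :=
  ⟨id, fun h h' => .mp h' h⟩

namespace IsGlobal

variable {Γ : Set Form} {A B C : Form}

theorem inst_mem (h : IsGlobal Γ) {D : Form} (hD : AxSMinusBot2 D) (A B C : Form) :
    D.inst A B C ∈ Γ :=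
  h.provable_mem (hD.provable_inst A B C)

theorem sup_of_imp (h : IsGlobal Γ) (hAB : (A ⟶ B) ∈ Γ) : A ⊐ B ∈ Γ :=
  h.mp (h.inst_mem .axM1 A B .bot) hAB

theorem isTheory_imp (h : IsGlobal Γ) : IsTheory Form.imp Γ := by
  have mp {A B : Form} (hAB : (A ⟶ B) ∈ Γ) (hA : A ∈ Γ) : B ∈ Γ := h.mp (h.sup_of_imp hAB) hA
  have const (A B : Form) : (A ⟶ (B ⟶ A)) ∈ Γ := h.inst_mem .ax1 A B .bot
  have distrib (A B C : Form) : ((A ⟶ (B ⟶ C)) ⟶ ((A ⟶ B) ⟶ (A ⟶ C))) ∈ Γ :=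
    h.inst_mem .ax2 A B C
  exact ⟨fun A => mp (mp (distrib A (A ⟶ A) A) (const A (A ⟶ A))) (const A A), const, distrib, mp⟩

theorem imp_sup_mem (h : IsGlobal Γ) (A B : Form) : (B ⟶ (A ⊐ B)) ∈ Γ := by
  have h1 : A ⊐ (B ⟶ B) ∈ Γ :=
    h.sup_of_imp (h.isTheory_imp.weaken A (h.isTheory_imp.refl_mem B))
  exact h.isTheory_imp.mp (h.inst_mem .axM3 A B B) h1

theorem isTheory_sup (h : IsGlobal Γ) : IsTheory Form.sup Γ where
  refl_mem A := h.sup_of_imp (h.isTheory_imp.refl_mem A)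
  const_mem A B := h.sup_of_imp (h.imp_sup_mem B A)
  distrib_mem A B C := h.sup_of_imp (h.inst_mem .axM2 A B C)
  mp := h.mp

theorem sup_imp_mem (h : IsGlobal Γ) (hA : A ∈ Γ) : ((A ⊐ B) ⟶ B) ∈ Γ :=
  h.mp (h.isTheory_imp.mp (h.inst_mem .axM4 (A ⊐ B) A B) (h.isTheory_imp.refl_mem (A ⊐ B))) hA

/-- If a set of formulas is maximal with respect to omitting `A`, then it contains every
`B ⊐ C` with `B` outside it. -/
theorem sup_mem_of_notMem (h : IsGlobal Γ) (hA : A ∉ Γ) (hmax : ∀ D ∉ Γ, D ⊐ A ∈ Γ)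
    (hB : B ∉ Γ) : B ⊐ C ∈ Γ := by
  by_contra hBC
  exact hA (h.isTheory_imp.mp
    (h.isTheory_imp.mp (h.inst_mem .axM5 B C A) (hmax _ hBC)) (hmax _ hB))

end IsGlobal

/-- A consistent prime theory (for `⟶`) that includes `Γ`. -/
structure IsPrimeOver (Γ Δ : Set Form) : Prop where
  subset : Γ ⊆ Δ
  isTheory : IsTheory Form.imp Δ
  bot_notMem : Form.bot ∉ Δ
  prime : ∀ {A B}, A ⋎ B ∈ Δ → A ∈ Δ ∨ B ∈ Δ

theorem IsGlobal.exists_isPrimeOver {Γ T : Set Form} (h : IsGlobal Γ) (hΓT : Γ ⊆ T)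
    (hT : IsTheory Form.imp T) {A : Form} (hA : A ∉ T) :
    ∃ Δ, T ⊆ Δ ∧ IsPrimeOver Γ Δ ∧ A ∉ Δ := by
  obtain ⟨Δ, hTΔ, hΔ, hAΔ, hmax⟩ := hT.exists_maximal hA
  have hΓΔ := hΓT.trans hTΔ
  refine ⟨Δ, hTΔ, ⟨hΓΔ, hΔ, fun hbot => ?_, fun {B C} hBC => ?_⟩, hAΔ⟩
  · exact hAΔ (hΔ.mp (hΓΔ (h.inst_mem .ax0 A .bot .bot)) hbot)
  · by_contra! hno
    exact hAΔ (hΔ.mp (hΔ.mp (hΔ.mp (hΓΔ (h.inst_mem .ax8 B C A)) (hmax B hno.1))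
      (hmax C hno.2)) hBC)

/-- The formulas common to all consistent prime theories that include `Γ` are those of `Γ`. -/
theorem IsGlobal.mem_iff_forall {Γ : Set Form} (h : IsGlobal Γ) {A : Form} :
    A ∈ Γ ↔ ∀ Δ, IsPrimeOver Γ Δ → A ∈ Δ := by
  refine ⟨fun hA Δ hΔ => hΔ.subset hA, fun hA => ?_⟩
  by_contra hno
  obtain ⟨Δ, -, hΔ, hAΔ⟩ := h.exists_isPrimeOver subset_rfl h.isTheory_imp hno
  exact hAΔ (hA Δ hΔ)

/-- The model whose states are the consistent prime theories that include `Γ`, ordered by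
inclusion. -/
def canonicalModel (Γ : Set Form) : Model.{0} where
  W := {Δ : Set Form // IsPrimeOver Γ Δ}
  le Δ Θ := Δ.1 ⊆ Θ.1
  le_refl _ := subset_rfl
  le_trans _ _ _ := Set.Subset.trans
  V Δ p := Form.var p ∈ Δ.1
  persistent _ _ _ h h' := h h'

/-- The truth lemma: the formulas true at a state of the canonical model are its elements. -/
theorem IsGlobal.holds_canonicalModel {Γ : Set Form} (h : IsGlobal Γ) {A : Form} (hA : A ∉ Γ)
    (hmax : ∀ D ∉ Γ, D ⊐ A ∈ Γ) (B : Form) :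
    ∀ Δ : (canonicalModel Γ).W, (canonicalModel Γ).Holds Δ B ↔ B ∈ Δ.1 := by
  induction B with
  | var p => exact fun _ => Iff.rfl
  | bot => exact fun Δ => iff_of_false id Δ.2.bot_notMem
  | and B C ihB ihC =>
    rintro ⟨Δ, hΔ⟩
    refine (and_congr (ihB _) (ihC _)).trans ⟨fun ⟨hB, hC⟩ => ?_, fun hBC => ⟨?_, ?_⟩⟩
    · -- The conjunction schema is applied with the conditional `B ⟶ B` as its premise `r`.
      have hr := hΔ.isTheory.refl_mem B
      have h5 := hΔ.subset (h.inst_mem .ax5 B C (B ⟶ B))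
      exact hΔ.isTheory.mp (hΔ.isTheory.mp (hΔ.isTheory.mp h5 (hΔ.isTheory.weaken _ hB))
        (hΔ.isTheory.weaken _ hC)) hr
    · exact hΔ.isTheory.mp (hΔ.subset (h.inst_mem .ax3 B C .bot)) hBC
    · exact hΔ.isTheory.mp (hΔ.subset (h.inst_mem .ax4 B C .bot)) hBC
  | or B C ihB ihC =>
    rintro ⟨Δ, hΔ⟩
    refine (or_congr (ihB _) (ihC _)).trans ⟨?_, hΔ.prime⟩
    rintro (hB | hC)
    · exact hΔ.isTheory.mp (hΔ.subset (h.inst_mem .ax6 B C .bot)) hB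
    · exact hΔ.isTheory.mp (hΔ.subset (h.inst_mem .ax7 B C .bot)) hC
  | imp B C ihB ihC =>
    rintro ⟨Δ, hΔ⟩
    constructor
    · intro hBC
      by_contra hno
      obtain ⟨Θ, hΔΘ, hΘ, hC⟩ := h.exists_isPrimeOver
        (hΔ.subset.trans (hΔ.isTheory.subset_adjoin B)) (hΔ.isTheory.adjoin B) hno
      refine hC ((ihC ⟨Θ, hΘ⟩).1 (hBC ⟨Θ, hΘ⟩ ?_ ((ihB ⟨Θ, hΘ⟩).2 ?_)))
      · exact (hΔ.isTheory.subset_adjoin B).trans hΔΘ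
      · exact hΔΘ (hΔ.isTheory.refl_mem B)
    · exact fun hBC Θ hΔΘ hB => (ihC Θ).2 (Θ.2.isTheory.mp (hΔΘ hBC) ((ihB Θ).1 hB))
  | sup B C ihB ihC =>
    rintro ⟨Δ, hΔ⟩
    have hglobal : (∀ Θ, (canonicalModel Γ).Holds Θ B) ↔ B ∈ Γ := by
      rw [h.mem_iff_forall]
      exact ⟨fun hB Θ hΘ => (ihB ⟨Θ, hΘ⟩).1 (hB ⟨Θ, hΘ⟩), fun hB Θ => (ihB Θ).2 (hB Θ.1 Θ.2)⟩
    refine Model.holds_sup_iff.trans ((imp_congr hglobal (ihC _)).trans ⟨?_, ?_⟩)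
    · intro hBC
      by_cases hB : B ∈ Γ
      · exact hΔ.isTheory.mp (hΔ.subset (h.imp_sup_mem B C)) (hBC hB)
      · exact hΔ.subset (h.sup_mem_of_notMem hA hmax hB)
    · exact fun hBC hB => hΔ.isTheory.mp (hΔ.subset (h.sup_imp_mem hB)) hBC

/-- Completeness of the smaller system for all models. -/
theorem provable_of_validSMinusBot {A : Form} (hA : ValidSMinusBot.{0} A) :
    Provable AxSMinusBot2 A := by
  by_contra hno
  obtain ⟨Γ, hΓ, hΓ', hAΓ, hmax⟩ := isGlobal_provable.isTheory_sup.exists_maximal hno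
  have h : IsGlobal Γ := ⟨fun hB => hΓ hB, hΓ'.mp⟩
  exact hAΓ (h.mem_iff_forall.2 fun Δ hΔ =>
    (h.holds_canonicalModel hAΓ hmax A ⟨Δ, hΔ⟩).1 (hA _ _))

end SLogic

theorem mainTheorem4 (A : SLogic.Form) (hA : A.DisjFree) :
    (SLogic.ValidSBot.{u} A → SLogic.ValidSMinusBot.{u} A) ∧
    (SLogic.Provable SLogic.AxSBot2 A → SLogic.Provable SLogic.AxSMinusBot2 A) :=
  ⟨fun h => h.validSMinusBot hA,
    fun h => SLogic.provable_of_validSMinusBot (h.validSBot.validSMinusBot hA)⟩
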